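/- Throughout, a compact plane set is a non-empty compact set $X\subset\mathbb C$, a path in $X$ is a continuous map $\gamma:[a,b]\to X$ with $a<b$, $\gamma^*=\gamma([a,b])$ is its image, and a subpath of $\gamma$ is a restriction of $\gamma$ to a non-degenerate closed subinterval of $[a,b]$. A path is a Jordan path if it is injective, rectifiable if it has finite length, and admissible if it is rectifiable and has no constant subpath. A collection $\mathcal F$ of paths in $X$ is effective if $\bigcup_{\gamma\in\mathcal F}\gamma^*$ is dense in $X$, each $\gamma\in\mathcal F$ is admissible, and each subpath of a path in $\mathcal F$ belongs to $\mathcal F$. The set $X$ is semi-rectifiable if the rectifiable Jordan paths in $X$ form an effective collection, i.e. if the union of their images is dense in $X$. For $f,g\in C(X)$ we say that $g$ is an $\mathcal F$-derivative of $f$ if $\int_\gamma g(z)\,dz=f(\gamma(b))-f(\gamma(a))$ for every path $\gamma:[a,b]\to X$ in $\mathcal F$; if $\mathcal F$ is effective, such a $g$ is unique if it exists, and is denoted by $f^{[1]}$. Put $f^{[0]}=f$ and define the higher $\mathcal F$-derivatives $f^{[k]}$ inductively. Let $D^{(\infty)}_{\mathcal F}(X)$ be the set of all $f\in C(X)$ that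 have $\mathcal F$-derivatives of all orders. An algebra sequence is a sequence $M=(M_n)_{n\ge 0}$ of positive real numbers with $M_0=1$ and $\binom{j+k}{k}\le M_{j+k}/(M_jM_k)$ for all $j,k\ge 0$. For such $M$ let $$D_{\mathcal F}(X,M)=\Bigl\{f\in D^{(\infty)}_{\mathcal F}(X):\ \sum_{j=0}^\infty \frac{1}{M_j}\sup_{x\in X}|f^{[j]}(x)|<\infty\Bigr\}.$$ Corollary. Let $X$ be a semi-rectifiable compact plane set, let $\mathcal F$ be an effective collection of paths in $X$, and let $M=(M_n)_{n\ge 0}$ be an algebra sequence with $\sum_{n=1}^\infty M_n^{-1/n}=+\infty$. Then $D_{\mathcal F}(X,M)$ is $\mathcal F$-quasianalytic: if $f\in D_{\mathcal F}(X,M)$, $\gamma\in\mathcal F$ and $z_0\in\gamma^*$ satisfy $f^{[k]}(z_0)=0$ for all $k=0,1,2,\dots$, then $f(z)=0$ for all $z\in\gamma^*$. -/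

import Mathlib

noncomputable section

/-- A path in a plane set `X`: a continuous map from a non-degenerate compact interval
`[a, b]` into `X`. -/
structure PlanePath (X : Set ℂ) where
  a : ℝ
  b : ℝ
  lt : a < b
  toFun : C(Set.Icc a b, X)

namespace PlanePath

variable {X : Set ℂ}

/-- The path as a function on `ℝ`, continued by its endpoint values outside `[a, b]`. -/
def extend (γ : PlanePath X) : ℝ → X := Set.IccExtend γ.lt.le γ.toFun

/-- The initial point of the path. -/
def init (γ : PlanePath X) : X := γ.toFun ⟨γ.a, Set.left_mem_Icc.2 γ.lt.le⟩

/-- The final point of the path. -/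
def final (γ : PlanePath X) : X := γ.toFun ⟨γ.b, Set.right_mem_Icc.2 γ.lt.le⟩

/-- The image of the path. -/
def image (γ : PlanePath X) : Set X := Set.range γ.toFun

/-- The restriction of a path to a non-degenerate closed subinterval `[c, d]` of `[a, b]`. -/
def restrict (γ : PlanePath X) (c d : ℝ) (hac : γ.a ≤ c) (hcd : c < d) (hdb : d ≤ γ.b) :
    PlanePath X where
  a := c
  b := d
  lt := hcd
  toFun := γ.toFun.comp (ContinuousMap.inclusion (Set.Icc_subset_Icc hac hdb))

/-- `σ` is a subpath of `γ`. -/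
def IsSubpath (σ γ : PlanePath X) : Prop :=
  ∃ (c d : ℝ) (hac : γ.a ≤ c) (hcd : c < d) (hdb : d ≤ γ.b), σ = γ.restrict c d hac hcd hdb

/-- The length of a path: its total variation. -/
def length (γ : PlanePath X) : ENNReal :=
  eVariationOn (fun t : Set.Icc γ.a γ.b => (γ.toFun t : ℂ)) Set.univ

/-- A path is rectifiable if its length is finite. -/
def IsRectifiable (γ : PlanePath X) : Prop := γ.length ≠ ⊤

/-- A path is constant if it takes a single value. -/
def IsConstant (γ : PlanePath X) : Prop := ∃ w : X, ∀ t, γ.toFun t = w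

/-- A path is a Jordan path if it is injective. -/
def IsJordan (γ : PlanePath X) : Prop := Function.Injective γ.toFun

/-- A path is admissible if it is rectifiable and has no constant subpaths. -/
def IsAdmissible (γ : PlanePath X) : Prop :=
  γ.IsRectifiable ∧ ∀ σ : PlanePath X, σ.IsSubpath γ → ¬ σ.IsConstant

/-- `γ.HasIntegral g I` says that the Riemann-Stieltjes integral `∫_γ g(z) dz` exists and equals
`I`: the sums `∑ g(γ(τᵢ)) (γ(tᵢ₊₁) - γ(tᵢ))` over the tagged partitions
`a = t₀ ≤ t₁ ≤ ⋯ ≤ tₙ = b`, `τᵢ ∈ [tᵢ, tᵢ₊₁]`, converge to `I` as the mesh tends to `0`. -/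
def HasIntegral (γ : PlanePath X) (g : X → ℂ) (I : ℂ) : Prop :=
  ∀ ε > 0, ∃ δ > 0, ∀ (n : ℕ) (t τ : ℕ → ℝ), t 0 = γ.a → t n = γ.b →
    (∀ i < n, t i ≤ τ i ∧ τ i ≤ t (i + 1) ∧ t (i + 1) - t i < δ) →
    ‖(∑ i ∈ Finset.range n,
        g (γ.extend (τ i)) * ((γ.extend (t (i + 1)) : ℂ) - (γ.extend (t i) : ℂ))) - I‖ < ε

end PlanePath

/-- A collection `F` of paths in `X` is effective if the union of the images of its paths is dense
in `X`, each of its paths is admissible, and it contains all subpaths of its paths. -/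
def IsEffective {X : Set ℂ} (F : Set (PlanePath X)) : Prop :=
  Dense (⋃ γ ∈ F, γ.image) ∧ (∀ γ ∈ F, γ.IsAdmissible) ∧
    ∀ γ ∈ F, ∀ σ : PlanePath X, σ.IsSubpath γ → σ ∈ F

/-- A plane set `X` is semi-rectifiable if the rectifiable Jordan paths in `X` form an effective
collection, that is, if their images have dense union in `X`. -/
def IsSemiRectifiable (X : Set ℂ) : Prop :=
  IsEffective {γ : PlanePath X | γ.IsJordan ∧ γ.IsRectifiable}

section FDerivatives

variable {X : Set ℂ} (F : Set (PlanePath X))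

/-- `g` is an `F`-derivative of `f` if `∫_γ g(z) dz = f(γ⁺) - f(γ⁻)` for each `γ ∈ F`. -/
def IsPathDeriv (f g : C(X, ℂ)) : Prop :=
  ∀ γ ∈ F, γ.HasIntegral g (f γ.final - f γ.init)

/-- `f` is `F`-differentiable if it has an `F`-derivative. -/
def IsPathDifferentiable (f : C(X, ℂ)) : Prop := ∃ g : C(X, ℂ), IsPathDeriv F f g

open Classical in
/-- The `F`-derivative of `f` (and `0` if `f` is not `F`-differentiable). It is unique if `F` is
effective. -/
def pathDeriv (f : C(X, ℂ)) : C(X, ℂ) :=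
  if h : IsPathDifferentiable F f then h.choose else 0

/-- The `k`-th `F`-derivative `f^[k]`, with `f^[0] = f`. -/
def iteratedPathDeriv (k : ℕ) (f : C(X, ℂ)) : C(X, ℂ) := (pathDeriv F)^[k] f

/-- The `n` times `F`-differentiable functions: `f` is `F`-differentiable and its `F`-derivative
is `n - 1` times `F`-differentiable. -/
def PathDiff : ℕ → Set C(X, ℂ)
  | 0 => Set.univ
  | n + 1 => {f | IsPathDifferentiable F f ∧ pathDeriv F f ∈ PathDiff n}

/-- The infinitely `F`-differentiable functions. -/
def PathDiffInfty : Set C(X, ℂ) := ⋂ n : ℕ, PathDiff F n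

/-- A set `A` of infinitely `F`-differentiable functions is `F`-quasianalytic if, whenever
`γ ∈ F`, `z₀ ∈ γ*` and `f ∈ A` satisfies `f^[k](z₀) = 0` for all `k ≥ 0`, then `f` vanishes on
all of `γ*`. -/
def IsPathQuasianalytic (A : Set C(X, ℂ)) : Prop :=
  A ⊆ PathDiffInfty F ∧
    ∀ γ ∈ F, ∀ z₀ ∈ γ.image, ∀ f ∈ A, (∀ k : ℕ, iteratedPathDeriv F k f z₀ = 0) →
      ∀ z ∈ γ.image, f z = 0

end FDerivatives

/-- An algebra sequence: positive reals with `M₀ = 1` and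
`(j + k choose k) ≤ M_{j+k} / (M_j M_k)`. -/
def IsAlgebraSequence (M : ℕ → ℝ) : Prop :=
  (∀ n, 0 < M n) ∧ M 0 = 1 ∧
    ∀ j k : ℕ, ((j + k).choose k : ℝ) ≤ M (j + k) / (M j * M k)

/-- The space `D_F(X, M)` of all infinitely `F`-differentiable functions `f` on the compact set `X`
with `∑ⱼ |f^[j]|_X / Mⱼ < ∞`, where `|·|_X` is the uniform norm. -/
def PathDalesDavie {X : Set ℂ} [CompactSpace X] (F : Set (PlanePath X)) (M : ℕ → ℝ) :
    Set C(X, ℂ) :=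
  {f | f ∈ PathDiffInfty F ∧ Summable fun j : ℕ => ‖iteratedPathDeriv F j f‖ / M j}

end

/-! This is Bang's proof of the Denjoy–Carleman theorem, with arc length `s` along `γ` in place of a
real variable. Let `w` be the largest convex minorant of `log M`, with increasing slopes `σ`. Since
`w n` is a sum of slopes, Carleman's inequality (`summable_exp_neg_average`) turns divergence of `∑
M_n^(-1/n)` into divergence of `∑ exp (-σ n)`.

Normalise so that `v n = K‖f^[n] ∘ γ‖ ≤ M n`. At a common zero, `v n ≤ exp (n - (k+1) + w n)` holds
for all `k`. By a Gronwall estimate, lowering `k` by one buys arc length `exp (-1 - σ (k+1))`. As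
these lengths have infinite sum, every level `k` can still be reached at the far end of the path by
starting high enough; letting `k → ∞` gives `v 0 = 0` there (`eq_zero_of_incrementsDominated`). -/

open Filter Finset

/-! ### Convex regularisation of `log M`. -/

/-- Greedy construction of the largest convex minorant of a superlinear sequence `a`. -/
lemma exists_convex_minorant (a : ℕ → ℝ) (ha : Tendsto (fun n : ℕ => a n / n) atTop atTop) :
    ∃ w σ : ℕ → ℝ, w 0 = a 0 ∧ (∀ n, w (n + 1) = w n + σ n) ∧ (∀ n, w n ≤ a n) ∧ Monotone σ ∧
      (∀ n, w (n + 1) = a (n + 1) ∨ σ (n + 1) = σ n) ∧ ∀ n, ∃ m ≥ n, w (m + 1) = a (m + 1) := by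
  -- Slopes from `(n, w)` to later points of the graph tend to infinity, so a least one exists.
  have key : ∀ (n : ℕ) (w : ℝ), ∃ j : ℕ, ∀ k : ℕ,
      (a (n + 1 + j) - w) / (j + 1) ≤ (a (n + 1 + k) - w) / (k + 1) := by
    intro n w
    apply Filter.Tendsto.exists_forall_le (f := fun k : ℕ => (a (n + 1 + k) - w) / ((k : ℝ) + 1))
    rw [Nat.cofinite_eq_atTop]
    have h1 : Tendsto (fun k : ℕ => a (n + 1 + k) / ((n + 1 + k : ℕ) : ℝ)) atTop atTop :=
      ha.comp (tendsto_atTop_mono (fun k => Nat.le_add_left k (n + 1)) tendsto_id)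
    have h2 : Tendsto (fun k : ℕ => a (n + 1 + k) / ((n + 1 + k : ℕ) : ℝ) + -|w|) atTop atTop :=
      tendsto_atTop_add_const_right _ _ h1
    refine tendsto_atTop_mono' _ ?_ h2
    filter_upwards [h1.eventually_ge_atTop 0] with k hk
    have hk1 : (0 : ℝ) < (k : ℝ) + 1 := by positivity
    have hn : (0 : ℝ) ≤ n := n.cast_nonneg
    have hN : (0 : ℝ) < ((n + 1 + k : ℕ) : ℝ) := by positivity
    have hpos : 0 ≤ a (n + 1 + k) := by
      by_contra hneg
      exact absurd (div_neg_of_neg_of_pos (not_le.1 hneg) hN) (not_lt.2 hk)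
    have e1 : a (n + 1 + k) / ((n + 1 + k : ℕ) : ℝ) ≤ a (n + 1 + k) / ((k : ℝ) + 1) := by
      apply div_le_div_of_nonneg_left hpos hk1
      push_cast; linarith
    have e2 : w / ((k : ℝ) + 1) ≤ |w| :=
      (div_le_div_of_nonneg_right (le_abs_self w) hk1.le).trans
        (div_le_self (abs_nonneg w) (by have := k.cast_nonneg (α := ℝ); linarith))
    rw [sub_div]
    linarith
  choose j hj using key
  let w : ℕ → ℝ := fun n => Nat.rec (a 0) (fun n w => w + (a (n + 1 + j n w) - w) / (j n w + 1)) n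
  let σ : ℕ → ℝ := fun n => (a (n + 1 + j n (w n)) - w n) / (j n (w n) + 1)
  have hw : ∀ n, w (n + 1) = w n + σ n := fun n => rfl
  have hle : ∀ n k : ℕ, w n + (k + 1) * σ n ≤ a (n + 1 + k) := by
    intro n k
    have := hj n (w n) k
    rw [le_div_iff₀ (by positivity)] at this
    change σ n * _ ≤ _ at this
    linarith
  have heq : ∀ n : ℕ, w n + ((j n (w n) : ℝ) + 1) * σ n = a (n + 1 + j n (w n)) := by
    intro n
    have h : ((j n (w n) : ℝ) + 1) ≠ 0 := by positivity
    simp only [σ]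
    field_simp
    ring
  have hwa : ∀ n, w n ≤ a n := by
    intro n
    cases n with
    | zero => exact le_rfl
    | succ n =>
      have := hle n 0
      rw [hw]
      simpa using this
  -- The line of slope `σ n` stays below the graph, hence below the next point of contact chosen
  -- from `n + 1`.
  have hmono : Monotone σ := by
    refine monotone_nat_of_le_succ fun n => ?_
    have h1 := hle n (j (n + 1) (w (n + 1)) + 1)
    have h2 := heq (n + 1)
    rw [show n + 1 + (j (n + 1) (w (n + 1)) + 1) = n + 1 + 1 + j (n + 1) (w (n + 1)) by ring,
      ← h2, hw] at h1
    push_cast at h1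
    have h3 : (0 : ℝ) < (j (n + 1) (w (n + 1)) : ℝ) + 1 := by positivity
    rw [← hw] at h1
    refine le_of_mul_le_mul_left ?_ h3
    rw [hw] at h1 ⊢
    linarith
  have hlow : ∀ n k : ℕ, w n + k * σ n ≤ w (n + k) := by
    intro n k
    induction k with
    | zero => simp
    | succ k ih =>
      rw [← add_assoc, hw]
      have := hmono (Nat.le_add_right n k)
      push_cast
      linarith
  refine ⟨w, σ, rfl, hw, hwa, hmono, fun n => ?_, fun n => ⟨n + j n (w n), by omega, ?_⟩⟩
  -- Either the chord from `n` already ends at `n + 1`, or its remaining part bounds the next slope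
  -- from above.
  · rcases Nat.eq_zero_or_pos (j n (w n)) with h0 | h0
    · left
      have := heq n
      rw [h0] at this
      rw [hw]
      simpa using this
    · right
      refine le_antisymm ?_ (hmono n.le_succ)
      obtain ⟨i, hi⟩ := Nat.exists_eq_succ_of_ne_zero h0.ne'
      have h1 := heq n
      have h2 := hle (n + 1) i
      rw [hi, show n + 1 + i.succ = n + 1 + 1 + i by omega] at h1
      rw [← h1, hw] at h2
      push_cast at h2
      have h3 : (0 : ℝ) < (i : ℝ) + 1 := by positivity
      refine le_of_mul_le_mul_left ?_ h3
      linarith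
  · refine le_antisymm (hwa (n + j n (w n) + 1)) ?_
    have h1 := heq n
    have h2 := hlow n (j n (w n) + 1)
    push_cast at h2
    rw [h1] at h2
    rwa [show n + 1 + j n (w n) = n + j n (w n) + 1 by ring] at h2

/-! ### Carleman's inequality. -/

/-- Summation by parts with `1/((i+1)(i+2)) = 1/(i+1) - 1/(i+2)`; for `b ≥ 0` it bounds the left
side by `∑ b k`. -/
lemma sum_weighted_averages (b : ℕ → ℝ) (n : ℕ) :
    ∑ i ∈ range n, (∑ k ∈ range (i + 1), ((k : ℝ) + 1) * b k) / (((i : ℝ) + 1) * (i + 2)) =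
      ∑ k ∈ range n, b k - (∑ k ∈ range n, ((k : ℝ) + 1) * b k) / (n + 1) := by
  induction n with
  | zero => simp
  | succ n ih =>
    rw [sum_range_succ, ih, sum_range_succ, sum_range_succ]
    push_cast
    have h1 : (n : ℝ) + 1 ≠ 0 := by positivity
    have h2 : (n : ℝ) + 2 ≠ 0 := by positivity
    rw [show (n : ℝ) + 1 + 1 = n + 2 by ring]
    field_simp
    ring

/-- A term of Carleman's inequality. -/
lemma exp_neg_average_le (σ : ℕ → ℝ) (n : ℕ) :
    Real.exp (-(∑ k ∈ range (n + 1), σ k) / (n + 1)) ≤ Real.exp 2 *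
      ((∑ k ∈ range (n + 1), ((k : ℝ) + 1) * Real.exp (-σ k)) / (((n : ℝ) + 1) * (n + 2))) := by
  have hn : (0 : ℝ) < (n : ℝ) + 1 := by positivity
  have hn2 : (0 : ℝ) < (n : ℝ) + 2 := by positivity
  -- AM–GM for the numbers `(k+1) exp (-σ k)`; the factors `k+1` contribute the geometric mean of
  -- `(n+1)!`, at least `(n+2)/e²` by `hfac`.
  have jensen := convexOn_exp.map_sum_le (t := range (n + 1)) (w := fun _ => 1 / ((n : ℝ) + 1))
    (p := fun k : ℕ => Real.log ((k : ℝ) + 1) - σ k) (fun _ _ => by positivity)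
    (by simp; field_simp) (fun _ _ => Set.mem_univ _)
  simp only [smul_eq_mul, ← mul_sum, sum_sub_distrib] at jensen
  have hexp : ∀ k : ℕ, Real.exp (Real.log ((k : ℝ) + 1) - σ k) = ((k : ℝ) + 1) * Real.exp (-σ k) := by
    intro k
    rw [sub_eq_add_neg, Real.exp_add, Real.exp_log (by positivity)]
  simp only [hexp] at jensen
  have hlog : ∑ k ∈ range (n + 1), Real.log ((k : ℝ) + 1) = Real.log ((n + 1).factorial) := by
    rw [← prod_range_add_one_eq_factorial, Nat.cast_prod, Real.log_prod (by intros; positivity)]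
    simp
  have hfac : ((n : ℝ) + 1) * (Real.log (n + 2) - 2) ≤ Real.log ((n + 1).factorial) := by
    have h := Real.pow_div_factorial_le_exp ((n : ℝ) + 2) hn2.le (n + 1)
    rw [div_le_iff₀ (by positivity)] at h
    have h' := Real.log_le_log (by positivity) h
    rw [Real.log_pow, Real.log_mul (Real.exp_pos _).ne' (by positivity), Real.log_exp] at h'
    push_cast at h'
    nlinarith [n.cast_nonneg (α := ℝ)]
  have h1 : Real.log (n + 2) - 2 - (∑ k ∈ range (n + 1), σ k) / (n + 1) ≤
      1 / ((n : ℝ) + 1) * (∑ k ∈ range (n + 1), Real.log ((k : ℝ) + 1) -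
        ∑ k ∈ range (n + 1), σ k) := by
    rw [hlog, mul_sub, one_div_mul_eq_div, one_div_mul_eq_div]
    gcongr
    rw [le_div_iff₀ hn]
    linarith
  have h2 := (Real.exp_le_exp.2 h1).trans jensen
  rw [show Real.log ((n : ℝ) + 2) - 2 - (∑ k ∈ range (n + 1), σ k) / ((n : ℝ) + 1) =
    Real.log ((n : ℝ) + 2) + (-2 + -(∑ k ∈ range (n + 1), σ k) / ((n : ℝ) + 1)) by ring,
    Real.exp_add, Real.exp_add, Real.exp_log hn2, Real.exp_neg] at h2
  have he := Real.exp_pos 2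
  calc Real.exp (-(∑ k ∈ range (n + 1), σ k) / (n + 1))
      = Real.exp 2 / (n + 2) * ((n + 2) * ((Real.exp 2)⁻¹ *
          Real.exp (-(∑ k ∈ range (n + 1), σ k) / (n + 1)))) := by field_simp
    _ ≤ Real.exp 2 / (n + 2) * (1 / ((n : ℝ) + 1) *
          ∑ k ∈ range (n + 1), ((k : ℝ) + 1) * Real.exp (-σ k)) := by gcongr
    _ = _ := by field_simp

/-- Carleman's inequality, in a qualitative form. -/
lemma summable_exp_neg_average (σ : ℕ → ℝ) (h : Summable fun k => Real.exp (-σ k)) :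
    Summable fun n : ℕ => Real.exp (-(∑ k ∈ range (n + 1), σ k) / (n + 1)) := by
  refine Summable.of_nonneg_of_le (fun _ => (Real.exp_pos _).le) (exp_neg_average_le σ) ?_
  refine Summable.mul_left _ ?_
  refine summable_of_sum_range_le (c := ∑' k, Real.exp (-σ k)) (fun n => ?_) fun n => ?_
  · exact div_nonneg (sum_nonneg fun k _ => by positivity) (by positivity)
  · rw [sum_weighted_averages]
    have h1 := h.sum_le_tsum (range n) fun _ _ => (Real.exp_pos _).le
    have h2 : 0 ≤ (∑ k ∈ range n, ((k : ℝ) + 1) * Real.exp (-σ k)) / ((n : ℝ) + 1) :=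
      div_nonneg (sum_nonneg fun k _ => by positivity) (by positivity)
    linarith

/-- The case `k = 1` of the binomial condition iterates to `M n ≥ n! (M 1)^n M 0`, and the factorial
wins. -/
lemma tendsto_log_div_of_choose_le (M : ℕ → ℝ) (hpos : ∀ n, 0 < M n)
    (hM : ∀ j k : ℕ, ((j + k).choose k : ℝ) ≤ M (j + k) / (M j * M k)) :
    Tendsto (fun n : ℕ => Real.log (M n) / n) atTop atTop := by
  have hfac : ∀ n : ℕ, (n.factorial : ℝ) * M 1 ^ n * M 0 ≤ M n := by
    intro n
    induction n with
    | zero => simp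
    | succ n ih =>
      have h := hM n 1
      rw [le_div_iff₀ (mul_pos (hpos _) (hpos _)), Nat.choose_one_right] at h
      refine le_trans ?_ h
      rw [Nat.factorial_succ, pow_succ]
      have := mul_le_mul_of_nonneg_left ih (mul_nonneg (n + 1).cast_nonneg (hpos 1).le)
      push_cast at this ⊢
      linarith
  have h1 : Tendsto (fun n : ℕ => Real.log (n : ℝ) + (-1 + Real.log (M 1) - |Real.log (M 0)|))
      atTop atTop :=
    tendsto_atTop_add_const_right _ _ (Real.tendsto_log_atTop.comp tendsto_natCast_atTop_atTop)
  refine tendsto_atTop_mono' _ ?_ h1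
  filter_upwards [eventually_ge_atTop 1] with n hn
  have hn0 : (1 : ℝ) ≤ n := by exact_mod_cast hn
  have hfl : (n : ℝ) * (Real.log n - 1) ≤ Real.log n.factorial := by
    have h := Real.pow_div_factorial_le_exp (n : ℝ) (by positivity) n
    rw [div_le_iff₀ (by positivity)] at h
    have h' := Real.log_le_log (by positivity) h
    rw [Real.log_pow, Real.log_mul (Real.exp_pos _).ne' (by positivity), Real.log_exp] at h'
    linarith
  have h2 := Real.log_le_log (by have := hpos 0; have := hpos 1; positivity) (hfac n)
  have hp : (M 1) ^ n ≠ 0 := (pow_pos (hpos 1) n).ne'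
  rw [Real.log_mul (mul_ne_zero (by positivity) hp) (hpos 0).ne', Real.log_mul (by positivity) hp,
    Real.log_pow] at h2
  rw [le_div_iff₀ (by linarith)]
  nlinarith [neg_abs_le (Real.log (M 0)), abs_nonneg (Real.log (M 0))]

/-! ### Bang's argument for abstract sequences of dominated functions. -/

/-- On `[a, b]`, the increments of `v` are approximately bounded by left Riemann-Stieltjes sums of
`v'` with respect to `s`. -/
def IncrementsDominated (s v v' : ℝ → ℝ) (a b : ℝ) : Prop :=
  ∀ c d, a ≤ c → c ≤ d → d ≤ b → ∀ ε > 0, ∃ (m : ℕ) (t : ℕ → ℝ), Monotone t ∧ t 0 = c ∧ t m = d ∧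
    v d ≤ v c + ∑ i ∈ range m, v' (t i) * (s (t (i + 1)) - s (t i)) + ε

section

variable {s : ℝ → ℝ} {v : ℕ → ℝ → ℝ} {a b : ℝ}

/-- Gronwall by downward induction on `n`. Left tags are essential: a left sum of `c exp (c s)` is
below the increment of `exp (c s)`, since `1 + u ≤ exp u`. -/
lemma IncrementsDominated.le_mul_exp (hs : Monotone s)
    (hv : ∀ n, IncrementsDominated s (v n) (v (n + 1)) a b) (N : ℕ) (B : ℕ → ℝ) (hB : ∀ n, 0 ≤ B n)
    (c : ℝ) (hc : 0 ≤ c) (hBc : ∀ n < N, B (n + 1) ≤ c * B n) (x : ℝ) (hx : a ≤ x)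
    (hvx : ∀ n < N, v n x ≤ B n) (hvN : ∀ y, x ≤ y → y ≤ b → v N y ≤ B N) (n : ℕ) (hn : n ≤ N) :
    ∀ y, x ≤ y → y ≤ b → v n y ≤ B n * Real.exp (c * (s y - s x)) := by
  induction hn using Nat.decreasingInduction with
  | self =>
    intro y hxy hyb
    refine (hvN y hxy hyb).trans (le_mul_of_one_le_right (hB N) (Real.one_le_exp ?_))
    exact mul_nonneg hc (sub_nonneg.2 (hs hxy))
  | of_succ n hn ih =>
    intro y hxy hyb
    refine le_of_forall_pos_le_add fun ε hε => ?_
    obtain ⟨m, t, ht, ht0, htm, hle⟩ := hv n x y hx hxy hyb ε hε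
    have hsum : ∑ i ∈ range m, v (n + 1) (t i) * (s (t (i + 1)) - s (t i)) ≤
        ∑ i ∈ range m, (B n * Real.exp (c * (s (t (i + 1)) - s x)) -
          B n * Real.exp (c * (s (t i) - s x))) := by
      refine sum_le_sum fun i hi => ?_
      have hxt : x ≤ t i := ht0 ▸ ht i.zero_le
      have hty : t i ≤ y := htm ▸ ht (mem_range.1 hi).le
      have hΔ : 0 ≤ s (t (i + 1)) - s (t i) := sub_nonneg.2 (hs (ht i.le_succ))
      have h1 := ih (t i) hxt (hty.trans hyb)
      have hE := Real.exp_pos (c * (s (t i) - s x))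
      have h2 : v (n + 1) (t i) ≤ c * B n * Real.exp (c * (s (t i) - s x)) :=
        h1.trans (mul_le_mul_of_nonneg_right (hBc n hn) hE.le)
      refine (mul_le_mul_of_nonneg_right h2 hΔ).trans ?_
      have h3 : Real.exp (c * (s (t (i + 1)) - s x)) =
          Real.exp (c * (s (t i) - s x)) * Real.exp (c * (s (t (i + 1)) - s (t i))) := by
        rw [← Real.exp_add]; ring_nf
      rw [h3]
      have h4 := Real.add_one_le_exp (c * (s (t (i + 1)) - s (t i)))
      have h5 := mul_le_mul_of_nonneg_left h4 (mul_nonneg (hB n) hE.le)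
      linarith
    rw [sum_range_sub (fun i => B n * Real.exp (c * (s (t i) - s x))), ht0, htm, sub_self, mul_zero,
      Real.exp_zero, mul_one] at hsum
    linarith [hvx n hn]

lemma IncrementsDominated.le_of_eq (hs : Monotone s) {u u' : ℝ → ℝ}
    (hu : IncrementsDominated s u u' a b) {x y : ℝ} (hx : a ≤ x) (hxy : x ≤ y) (hy : y ≤ b)
    (h : s y ≤ s x) : u y ≤ u x := by
  refine le_of_forall_pos_le_add fun ε hε => ?_
  obtain ⟨m, t, ht, ht0, htm, hle⟩ := hu x y hx hxy hy ε hε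
  rw [sum_eq_zero, add_zero] at hle
  · exact hle
  · intro i hi
    have h1 : s (t i) ≤ s (t (i + 1)) := hs (ht i.le_succ)
    have h2 : s (t (i + 1)) ≤ s y := hs (htm ▸ ht (mem_range.1 hi))
    have h3 : s x ≤ s (t i) := hs (ht0 ▸ ht i.zero_le)
    rw [show s (t (i + 1)) - s (t i) = 0 by linarith, mul_zero]

/-- Bang's form of the Denjoy-Carleman theorem. -/
theorem eq_zero_of_incrementsDominated (hs : Monotone s) (hsc : Continuous s) (hab : a ≤ b)
    (hv : ∀ n, IncrementsDominated s (v n) (v (n + 1)) a b) {M : ℕ → ℝ} (hpos : ∀ n, 0 < M n)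
    (hvM : ∀ n x, v n x ≤ M n) (hva : ∀ n, v n a = 0) {w σ : ℕ → ℝ}
    (hw : ∀ n, w (n + 1) = w n + σ n) (hσ : Monotone σ)
    (hor : ∀ n, w (n + 1) = Real.log (M (n + 1)) ∨ σ (n + 1) = σ n)
    (hinf : ∀ n, ∃ m ≥ n, w (m + 1) = Real.log (M (m + 1)))
    (hsum : ¬ Summable fun n => Real.exp (-σ n)) : v 0 b ≤ 0 := by
  -- Level `k` at `x`: `N + 1` is a contact index and the slopes are constant from `k` to `N`. At `n
  -- = N + 1` the bound would be free, because `v (N+1) ≤ M (N+1) = exp (w (N+1))` and `N ≥ k`.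
  let S : ℕ → ℝ → Prop := fun k x => ∃ N ≥ k, w (N + 1) = Real.log (M (N + 1)) ∧ σ N = σ k ∧
    ∀ n < N + 1, v n x ≤ Real.exp (n - (k + 1) + w n)
  let C : ℕ → ℝ := fun n => ∑ j ∈ range n, Real.exp (-1) * Real.exp (-σ j)
  -- The bounds for successive `n` have ratio `exp (1 + σ n) ≤ exp (1 + σ N)`, so over this arc
  -- length Gronwall loses at most a factor `e`, exactly one level.
  have hstep : ∀ k x y, a ≤ x → x ≤ y → y ≤ b → S (k + 1) x →
      s y - s x ≤ Real.exp (-1) * Real.exp (-σ (k + 1)) → S k y := by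
    rintro k x y hx hxy hyb ⟨N, hkN, hN, hNσ, hvx⟩ hd
    have hmain : ∀ n < N + 1, v n y ≤ Real.exp (n - (k + 1) + w n) := by
      intro n hn
      have h := IncrementsDominated.le_mul_exp hs hv (N + 1)
        (fun n => Real.exp (n - (((k + 1 : ℕ) : ℝ) + 1) + w n)) (fun n => (Real.exp_pos _).le)
        (Real.exp (1 + σ N)) (Real.exp_pos _).le ?_ x hx hvx ?_ n hn.le y hxy hyb
      · refine h.trans ?_
        rw [← Real.exp_add, Real.exp_le_exp]
        have h1 : Real.exp (1 + σ N) * (s y - s x) ≤ 1 := by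
          refine (mul_le_mul_of_nonneg_left hd (Real.exp_pos _).le).trans ?_
          rw [hNσ, ← Real.exp_add, ← Real.exp_add, Real.exp_le_one_iff]
          linarith
        push_cast
        linarith
      · intro n hn
        rw [← Real.exp_add, Real.exp_le_exp, hw]
        have := hσ (Nat.lt_succ_iff.1 hn)
        push_cast
        linarith
      · intro z _ _
        refine (hvM _ z).trans ?_
        rw [hN, ← Real.log_le_iff_le_exp (hpos _)]
        have : ((k + 1 : ℕ) : ℝ) ≤ N := by exact_mod_cast hkN
        push_cast at this ⊢
        linarith
    -- At a contact index `k + 1` the witness restarts at `N = k`; otherwise the slope is unchanged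
    -- and the old `N` serves.
    rcases hor k with h | h
    · exact ⟨k, le_rfl, h, rfl, fun n hn => hmain n (by omega)⟩
    · exact ⟨N, by omega, hN, hNσ.trans h, hmain⟩
  have hC : Tendsto C atTop atTop := by
    refine (not_summable_iff_tendsto_nat_atTop_of_nonneg fun n => by positivity).1 fun h => hsum ?_
    exact (summable_mul_left_iff (Real.exp_pos _).ne').1 h
  -- Descend from a contact level `K`, which holds at `a` by vanishing; `C` records the arc length
  -- bought so far.
  have hD : ∀ K, w (K + 1) = Real.log (M (K + 1)) → ∀ k ≤ K, ∀ x, a ≤ x → x ≤ b →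
      s x - s a ≤ C (K + 1) - C (k + 1) → S k x := by
    intro K hKw k hkK
    induction hkK using Nat.decreasingInduction with
    | self =>
      intro x hx hxb hle
      refine ⟨K, le_rfl, hKw, rfl, fun n _ => ?_⟩
      refine ((hv n).le_of_eq hs le_rfl hx hxb (by linarith)).trans ?_
      rw [hva]
      exact (Real.exp_pos _).le
    | of_succ k hk ih =>
      intro x hx hxb hle
      have hCk : C (k + 1 + 1) = C (k + 1) + Real.exp (-1) * Real.exp (-σ (k + 1)) :=
        sum_range_succ _ _
      have hCmono : C (k + 1 + 1) ≤ C (K + 1) :=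
        sum_le_sum_of_subset_of_nonneg (range_mono (by omega)) fun _ _ _ => by positivity
      rcases le_total (s x - s a) (C (K + 1) - C (k + 1 + 1)) with h | h
      · exact hstep k x x hx le_rfl hxb (ih x hx hxb h) (by rw [sub_self]; positivity)
      -- The point `y` is where the allowance of level `k + 1` runs out; continuity of `s` provides
      -- it.
      · obtain ⟨y, ⟨hay, hyx⟩, hy⟩ := intermediate_value_Icc hx hsc.continuousOn
          (show s a + (C (K + 1) - C (k + 1 + 1)) ∈ Set.Icc (s a) (s x) from
            ⟨by linarith, by linarith⟩)
        exact hstep k y x hay hyx hxb (ih y hay (hyx.trans hxb) (by linarith)) (by linarith)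
  have hSb : ∀ k, S k b := by
    intro k
    obtain ⟨K₀, hK₀⟩ := eventually_atTop.1 (hC.eventually_ge_atTop (C (k + 1) + (s b - s a)))
    obtain ⟨K, hK, hKw⟩ := hinf (max k K₀)
    have hbK := hK₀ (K + 1) (((le_max_right _ _).trans hK).trans K.le_succ)
    exact hD K hKw k ((le_max_left _ _).trans hK) b hab le_rfl (by linarith)
  have hlim : Tendsto (fun k : ℕ => Real.exp (-((k : ℝ) + (1 - w 0)))) atTop (nhds 0) :=
    (Real.tendsto_exp_neg_atTop_nhds_zero).comp
      (tendsto_atTop_add_const_right _ _ tendsto_natCast_atTop_atTop)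
  refine ge_of_tendsto' hlim fun k => ?_
  obtain ⟨N, _, _, _, h⟩ := hSb k
  refine (h 0 N.succ_pos).trans (le_of_eq ?_)
  push_cast
  ring_nf

end

/-! ### Arc length and Riemann–Stieltjes sums along a path. -/

namespace PlanePath

variable {X : Set ℂ} (γ : PlanePath X)

lemma continuous_extend : Continuous γ.extend := γ.toFun.continuous.Icc_extend'

lemma extend_of_mem {t : ℝ} (ht : t ∈ Set.Icc γ.a γ.b) : γ.extend t = γ.toFun ⟨t, ht⟩ :=
  Set.IccExtend_of_mem _ _ ht

lemma extend_restrict {c d : ℝ} (hac : γ.a ≤ c) (hcd : c < d) (hdb : d ≤ γ.b) {t : ℝ}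
    (ht : t ∈ Set.Icc c d) : (γ.restrict c d hac hcd hdb).extend t = γ.extend t := by
  rw [extend_of_mem _ (show t ∈ Set.Icc (γ.restrict c d hac hcd hdb).a _ from ht),
    extend_of_mem _ (Set.Icc_subset_Icc hac hdb ht)]
  rfl

lemma IsRectifiable.boundedVariationOn (h : γ.IsRectifiable) :
    BoundedVariationOn (fun t => (γ.extend t : ℂ)) Set.univ := by
  refine ne_top_of_le_ne_top h (eVariationOn.comp_le_of_monotoneOn
    (fun t : Set.Icc γ.a γ.b => (γ.toFun t : ℂ)) (Set.projIcc γ.a γ.b γ.lt.le)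
    ((Set.monotone_projIcc _).monotoneOn _) (Set.mapsTo_univ _ _))

/-- The signed length of the path between the parameters `γ.a` and `t`. -/
noncomputable def arcLength (t : ℝ) : ℝ :=
  variationOnFromTo (fun t => (γ.extend t : ℂ)) Set.univ γ.a t

variable {γ}

lemma IsRectifiable.monotone_arcLength (h : γ.IsRectifiable) : Monotone γ.arcLength :=
  monotoneOn_univ.1 (variationOnFromTo.monotoneOn
    (h.boundedVariationOn).locallyBoundedVariationOn (Set.mem_univ _))

lemma IsRectifiable.norm_sub_le (h : γ.IsRectifiable) {c d : ℝ} (hcd : c ≤ d) :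
    ‖(γ.extend d : ℂ) - γ.extend c‖ ≤ γ.arcLength d - γ.arcLength c := by
  have hl := h.boundedVariationOn.locallyBoundedVariationOn
  rw [arcLength, arcLength, variationOnFromTo.sub_right hl (Set.mem_univ _) (Set.mem_univ _)
    (Set.mem_univ _), variationOnFromTo.eq_of_le _ _ hcd, ← dist_eq_norm, dist_edist, edist_comm]
  refine ENNReal.toReal_mono (hl c d (Set.mem_univ _) (Set.mem_univ _)) ?_
  exact eVariationOn.edist_le (fun t => (γ.extend t : ℂ)) ⟨Set.mem_univ _, le_rfl, hcd⟩
    ⟨Set.mem_univ _, hcd, le_rfl⟩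

lemma IsRectifiable.continuous_arcLength (h : γ.IsRectifiable) : Continuous γ.arcLength := by
  have hl := h.boundedVariationOn.locallyBoundedVariationOn
  have hc : Continuous fun t => (γ.extend t : ℂ) := continuous_subtype_val.comp γ.continuous_extend
  refine continuous_iff_continuousAt.2 fun t => continuousAt_iff_continuous_left'_right'.2 ⟨?_, ?_⟩
  · have := variationOnFromTo.tendsto_left (a := γ.a) (b := t) (Set.mem_univ _) (Set.mem_univ _) hl
      (hc.continuousAt.tendsto.mono_left nhdsWithin_le_nhds)
    simpa [ContinuousWithinAt, arcLength] using! this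
  · have := variationOnFromTo.tendsto_right (a := γ.a) (b := t) (Set.mem_univ _) (Set.mem_univ _) hl
      (hc.continuousAt.tendsto.mono_left nhdsWithin_le_nhds)
    simpa [ContinuousWithinAt, arcLength] using! this

/-- An integral over `[c, d]` is approximated by sums over equidistant partitions with tags at the
left ends and with tags at the right ends. -/
lemma HasIntegral.exists_partition {g : X → ℂ} {I : ℂ} {c d : ℝ} {hac : γ.a ≤ c} {hcd : c < d}
    {hdb : d ≤ γ.b} (h : (γ.restrict c d hac hcd hdb).HasIntegral g I) {ε : ℝ} (hε : 0 < ε) :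
    ∃ (m : ℕ) (t : ℕ → ℝ), Monotone t ∧ t 0 = c ∧ t m = d ∧
      ‖(∑ i ∈ range m, g (γ.extend (t i)) *
        ((γ.extend (t (i + 1)) : ℂ) - (γ.extend (t i) : ℂ))) - I‖ < ε ∧
      ‖(∑ i ∈ range m, g (γ.extend (t (i + 1))) *
        ((γ.extend (t (i + 1)) : ℂ) - (γ.extend (t i) : ℂ))) - I‖ < ε := by
  obtain ⟨δ, hδ, H⟩ := h ε hε
  obtain ⟨m, hm⟩ := exists_nat_gt ((d - c) / δ)
  have hm0 : (0 : ℝ) < m := (div_pos (sub_pos.2 hcd) hδ).trans hm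
  rw [div_lt_iff₀ hδ] at hm
  let t : ℕ → ℝ := fun i => c + i * ((d - c) / m)
  have hq : 0 < (d - c) / m := div_pos (sub_pos.2 hcd) hm0
  have ht : Monotone t := by
    intro i j hij
    have : (i : ℝ) ≤ j := by exact_mod_cast hij
    simp only [t]
    gcongr
  have ht0 : t 0 = c := by simp [t]
  have htm : t m = d := by simp only [t]; field_simp; ring
  have hdiff : ∀ i, t (i + 1) - t i < δ := by
    intro i
    simp only [t]
    push_cast
    rw [show c + ((i : ℝ) + 1) * ((d - c) / m) - (c + i * ((d - c) / m)) = (d - c) / m by ring,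
      div_lt_iff₀ hm0]
    linarith
  have hext : ∀ i ≤ m, (γ.restrict c d hac hcd hdb).extend (t i) = γ.extend (t i) := fun i hi =>
    γ.extend_restrict hac hcd hdb ⟨ht0 ▸ ht i.zero_le, htm ▸ ht hi⟩
  refine ⟨m, t, ht, ht0, htm, ?_, ?_⟩
  · convert H m t t ht0 htm (fun i _ => ⟨le_rfl, ht i.le_succ, hdiff i⟩) using 3
    refine sum_congr rfl fun i hi => ?_
    have := mem_range.1 hi
    rw [hext i (by omega), hext (i + 1) (by omega)]
  · convert H m t (fun i => t (i + 1)) ht0 htm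
      (fun i _ => ⟨ht i.le_succ, le_rfl, hdiff i⟩) using 3
    refine sum_congr rfl fun i hi => ?_
    have := mem_range.1 hi
    rw [hext i (by omega), hext (i + 1) (by omega)]

lemma norm_stieltjesSum_le {r : ℕ → ℂ} {p : ℕ → ℝ} {t : ℕ → ℝ} (h : γ.IsRectifiable) (ht : Monotone t)
    (hr : ∀ i, ‖r i‖ = p i) (m : ℕ) :
    ‖∑ i ∈ range m, r i * ((γ.extend (t (i + 1)) : ℂ) - (γ.extend (t i) : ℂ))‖ ≤
      ∑ i ∈ range m, p i * (γ.arcLength (t (i + 1)) - γ.arcLength (t i)) := by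
  refine (norm_sum_le _ _).trans (sum_le_sum fun i _ => ?_)
  rw [norm_mul, hr]
  exact mul_le_mul_of_nonneg_left (h.norm_sub_le (ht i.le_succ)) (hr i ▸ norm_nonneg _)

end PlanePath

/-! ### Dominated increments of `F`-derivatives, in both directions along a path. -/

section

variable {X : Set ℂ} {F : Set (PlanePath X)} {f g : C(X, ℂ)} {γ : PlanePath X}

lemma IsPathDeriv.hasIntegral_restrict (hF : IsEffective F) (h : IsPathDeriv F f g) (hγ : γ ∈ F)
    {c d : ℝ} (hac : γ.a ≤ c) (hcd : c < d) (hdb : d ≤ γ.b) :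
    (γ.restrict c d hac hcd hdb).HasIntegral g (f (γ.extend d) - f (γ.extend c)) := by
  have := h _ (hF.2.2 γ hγ (γ.restrict c d hac hcd hdb) ⟨c, d, hac, hcd, hdb, rfl⟩)
  rw [γ.extend_of_mem ⟨hac.trans hcd.le, hdb⟩, γ.extend_of_mem ⟨hac, hcd.le.trans hdb⟩]
  exact this

/-- Closure of `F` under subpaths gives the integral formula on each `[c, d]`; chords are bounded by
arc length. -/
lemma IsPathDeriv.incrementsDominated (hF : IsEffective F) (h : IsPathDeriv F f g) (hγ : γ ∈ F)
    {K : ℝ} (hK : 0 ≤ K) {a : ℝ} (ha : γ.a ≤ a) :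
    IncrementsDominated γ.arcLength (fun t => K * ‖f (γ.extend t)‖) (fun t => K * ‖g (γ.extend t)‖)
      a γ.b := by
  intro c d hac hcd hdb ε hε
  rcases hcd.eq_or_lt with rfl | hcd
  · exact ⟨0, fun _ => c, monotone_const, rfl, rfl, by simpa using hε.le⟩
  -- Dividing by `K + 1` rather than `K` allows `K = 0`.
  obtain ⟨m, t, ht, ht0, htm, hl, -⟩ := (h.hasIntegral_restrict hF hγ (ha.trans hac) hcd
    hdb).exists_partition (show 0 < ε / (K + 1) by positivity)
  refine ⟨m, t, ht, ht0, htm, ?_⟩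
  have h1 := PlanePath.norm_stieltjesSum_le (hF.2.1 γ hγ).1 ht (fun i => rfl) m
    (r := fun i => g (γ.extend (t i)))
  have h2 := norm_sub_norm_le (f (γ.extend d)) (f (γ.extend c))
  have h3 := norm_sub_norm_le (f (γ.extend d) - f (γ.extend c)) (∑ i ∈ range m, g (γ.extend (t i)) *
        ((γ.extend (t (i + 1)) : ℂ) - (γ.extend (t i) : ℂ)))
  rw [norm_sub_rev (f (γ.extend d) - f (γ.extend c))] at h3
  have h4 : K * (ε / (K + 1)) ≤ ε := by
    rw [← mul_div_assoc, div_le_iff₀ (by positivity)]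
    nlinarith
  have h5 : K * ‖f (γ.extend d)‖ ≤ K * (‖f (γ.extend c)‖ +
      ∑ i ∈ range m, ‖g (γ.extend (t i))‖ * (γ.arcLength (t (i + 1)) - γ.arcLength (t i)) +
        ε / (K + 1)) := mul_le_mul_of_nonneg_left (by linarith) hK
  rw [mul_add, mul_add, mul_sum] at h5
  simp only [mul_assoc]
  linarith

/-- Reversing the parameter turns right tags into left tags, so the reversed path need not lie in
`F`. -/
lemma IsPathDeriv.incrementsDominated_neg (hF : IsEffective F) (h : IsPathDeriv F f g)
    (hγ : γ ∈ F) {K : ℝ} (hK : 0 ≤ K) {a : ℝ} (ha : -γ.b ≤ a) :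
    IncrementsDominated (fun t => -γ.arcLength (-t)) (fun t => K * ‖f (γ.extend (-t))‖)
      (fun t => K * ‖g (γ.extend (-t))‖) a (-γ.a) := by
  intro c d hac hcd hdb ε hε
  rcases hcd.eq_or_lt with rfl | hcd
  · exact ⟨0, fun _ => c, monotone_const, rfl, rfl, by simpa using hε.le⟩
  obtain ⟨m, t, ht, ht0, htm, -, hl⟩ := (h.hasIntegral_restrict hF hγ (le_neg.2 hdb)
    (neg_lt_neg hcd) (neg_le.1 (ha.trans hac))).exists_partition
      (show 0 < ε / (K + 1) by positivity)
  refine ⟨m, fun i => -t (m - i), fun i j hij => neg_le_neg (ht (by omega)), by simp [htm],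
    by simp [ht0], ?_⟩
  have h1 := PlanePath.norm_stieltjesSum_le (hF.2.1 γ hγ).1 ht (fun i => rfl) m
    (r := fun i => g (γ.extend (t (i + 1))))
  have h2 := norm_sub_norm_le (f (γ.extend (-d))) (f (γ.extend (-c)))
  rw [norm_sub_rev] at h2
  have h3 := norm_sub_norm_le (f (γ.extend (-c)) - f (γ.extend (-d)))
    (∑ i ∈ range m, g (γ.extend (t (i + 1))) *
        ((γ.extend (t (i + 1)) : ℂ) - (γ.extend (t i) : ℂ)))
  rw [norm_sub_rev (f (γ.extend (-c)) - f (γ.extend (-d)))] at h3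
  have h4 : K * (ε / (K + 1)) ≤ ε := by
    rw [← mul_div_assoc, div_le_iff₀ (by positivity)]
    nlinarith
  have h5 : K * ‖f (γ.extend (-d))‖ ≤ K * (‖f (γ.extend (-c))‖ +
      ∑ i ∈ range m, ‖g (γ.extend (t (i + 1)))‖ * (γ.arcLength (t (i + 1)) - γ.arcLength (t i)) +
        ε / (K + 1)) := mul_le_mul_of_nonneg_left (by linarith) hK
  rw [mul_add, mul_add, mul_sum, ← sum_range_reflect] at h5
  refine h5.trans (add_le_add (add_le_add_right (le_of_eq (sum_congr rfl fun i hi => ?_)) _) h4)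
  have hi := mem_range.1 hi
  rw [show m - 1 - i + 1 = m - i by omega, show m - 1 - i = m - (i + 1) by omega]
  simp only [neg_neg]
  ring

lemma IsPathDifferentiable.isPathDeriv_pathDeriv (h : IsPathDifferentiable F f) :
    IsPathDeriv F f (pathDeriv F f) := by
  rw [pathDeriv, dif_pos h]
  exact h.choose_spec

/-- Membership in `PathDiffInfty` keeps every iterate away from the default value `0` of
`pathDeriv`. -/
lemma isPathDeriv_iteratedPathDeriv (hf : f ∈ PathDiffInfty F) (n : ℕ) :
    IsPathDeriv F (iteratedPathDeriv F n f) (iteratedPathDeriv F (n + 1) f) := by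
  have h : ∀ n (f : C(X, ℂ)), f ∈ PathDiff F (n + 1) →
      IsPathDifferentiable F (iteratedPathDeriv F n f) := by
    intro n
    induction n with
    | zero => exact fun f hf => hf.1
    | succ n ih => exact fun f hf => ih _ hf.2
  have h1 := (h n f (Set.mem_iInter.1 hf (n + 1))).isPathDeriv_pathDeriv
  rwa [iteratedPathDeriv, iteratedPathDeriv, Function.iterate_succ_apply']

end

/-! ### Quasianalyticity along the paths of `F`. -/

theorem mainTheorem3 (X : Set ℂ) [Nonempty X] [CompactSpace X] (hX : IsSemiRectifiable X)
    (F : Set (PlanePath X)) (hF : IsEffective F)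
    (M : ℕ → ℝ) (hM : IsAlgebraSequence M)
    (hsum : ¬ Summable fun n : ℕ => M (n + 1) ^ (-(1 : ℝ) / ((n : ℝ) + 1))) :
    IsPathQuasianalytic F (PathDalesDavie F M) := by
  refine ⟨fun f hf => hf.1, ?_⟩
  rintro γ hγ _ ⟨⟨t₀, ht₀⟩, rfl⟩ f ⟨hf, hfM⟩ hz _ ⟨⟨t₁, ht₁⟩, rfl⟩
  obtain ⟨hpos, hM0, hbin⟩ := hM
  obtain ⟨w, σ, hw0, hw, hwM, hσ, hor, hinf⟩ := exists_convex_minorant (fun n => Real.log (M n))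
    (tendsto_log_div_of_choose_le M hpos hbin)
  have hσsum : ¬ Summable fun n => Real.exp (-σ n) := by
    intro h
    refine hsum (Summable.of_nonneg_of_le (fun n => Real.rpow_nonneg (hpos _).le _) (fun n => ?_)
      (summable_exp_neg_average σ h))
    -- `M 0 = 1` makes `w 0 = 0`, so `w (n+1) / (n+1)` is exactly an average of slopes.
    have hwsum : ∀ n, w n = ∑ k ∈ range n, σ k := by
      intro n
      induction n with
      | zero => simpa [hM0] using hw0
      | succ n ih => rw [hw, ih, sum_range_succ]
    rw [Real.rpow_def_of_pos (hpos _), Real.exp_le_exp, ← hwsum, ← mul_div_assoc, mul_neg_one]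
    gcongr
    exact hwM _
  have hnn : ∀ n, 0 ≤ ‖iteratedPathDeriv F n f‖ / M n := fun n =>
    div_nonneg (norm_nonneg _) (hpos n).le
  -- The added `1` keeps the denominator positive when `f = 0`.
  let K : ℝ := (∑' n, ‖iteratedPathDeriv F n f‖ / M n + 1)⁻¹
  have hK1 : 0 < ∑' n, ‖iteratedPathDeriv F n f‖ / M n + 1 :=
    add_pos_of_nonneg_of_pos (tsum_nonneg hnn) one_pos
  have hK : 0 < K := inv_pos.2 hK1
  have hbound : ∀ n (x : X), K * ‖iteratedPathDeriv F n f x‖ ≤ M n := by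
    intro n x
    have h1 := (iteratedPathDeriv F n f).norm_coe_le_norm x
    have h2 := hfM.le_tsum n fun m _ => hnn m
    rw [div_le_iff₀ (hpos n)] at h2
    rw [inv_mul_le_iff₀ hK1]
    nlinarith [hpos n]
  have hrect := (hF.2.1 γ hγ).1
  have hder := isPathDeriv_iteratedPathDeriv hf
  rw [← γ.extend_of_mem ht₁]
  rw [← γ.extend_of_mem ht₀] at hz
  suffices h : K * ‖iteratedPathDeriv F 0 f (γ.extend t₁)‖ ≤ 0 by
    exact norm_le_zero_iff.1 (nonpos_of_mul_nonpos_right h hK)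
  rcases le_total t₀ t₁ with h01 | h10
  · refine eq_zero_of_incrementsDominated hrect.monotone_arcLength hrect.continuous_arcLength h01
      (v := fun n t => K * ‖iteratedPathDeriv F n f (γ.extend t)‖) (fun n => ?_) hpos
      (fun n x => hbound n _) (fun n => by simp [hz]) hw hσ hor hinf hσsum
    exact fun c d hc hcd hd =>
      (hder n).incrementsDominated hF hγ hK.le ht₀.1 c d hc hcd (hd.trans ht₁.2)
  -- For a target before the zero, run the argument in the parameter `-t`, with `-γ.arcLength (-t)`
  -- as increasing arc length.
  · rw [← neg_neg t₁]
    refine eq_zero_of_incrementsDominated (s := fun t => -γ.arcLength (-t))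
      (fun x y hxy => neg_le_neg (hrect.monotone_arcLength (neg_le_neg hxy)))
      (hrect.continuous_arcLength.comp continuous_neg).neg (neg_le_neg h10)
      (v := fun n t => K * ‖iteratedPathDeriv F n f (γ.extend (-t))‖) (fun n => ?_) hpos
      (fun n x => hbound n _) (fun n => by simp [hz]) hw hσ hor hinf hσsum
    exact fun c d hc hcd hd => (hder n).incrementsDominated_neg hF hγ hK.le (neg_le_neg ht₀.2)
      c d hc hcd (hd.trans (neg_le_neg ht₁.1))
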